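/- Let $(M,\phi,\xi,\eta,g_M)$ be a Sasakian manifold, i.e. a smooth (finite-dimensional, Hausdorff, second countable, boundaryless) Riemannian manifold with a smooth $(1,1)$-tensor field $\phi$, vector field $\xi$ and $1$-form $\eta$ such that $$\phi^2=-I+\eta\otimes\xi,\quad \phi\xi=0,\quad \eta\circ\phi=0,\quad \eta(\xi)=1,\quad g_M(\phi X,\phi Y)=g_M(X,Y)-\eta(X)\eta(Y),\quad \eta(X)=g_M(X,\xi),$$ and, with $d\eta(X,Y)=X\eta(Y)-Y\eta(X)-\eta([X,Y])$ and $N_\phi$ the Nijenhuis tensor of $\phi$, $$\tfrac12 d\eta(X,Y)=g_M(X,\phi Y),\qquad N_\phi+d\eta\otimes\xi=0$$ (so that $(\nabla_X\phi)Y=g_M(X,Y)\xi-\eta(Y)X$ for the Levi-Civita connection $\nabla$). Let $(N,g_N)$ be a Riemannian manifold and let $F:M\to N$ be an anti-invariant Riemannian submersion: $F$ is smooth, onto, of maximal rank, $F_*$ preserves the lengths of vectors in $(\ker F_*)^\perp$, and $\phi(\ker F_*)\subseteq(\ker F_*)^\perp$. Assume that $\xi$ is vertical, i.e. $\xi\in\Gamma(\ker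 F_*)$. Let $\mathcal V,\mathcal H$ be the orthogonal projections onto $\ker F_*$ and $(\ker F_*)^\perp$; for vector fields $X,Z$ on $M$ put $\mathcal A_XZ=\mathcal V\nabla_{\mathcal HX}\mathcal HZ+\mathcal H\nabla_{\mathcal HX}\mathcal VZ$; for $X\in\Gamma((\ker F_*)^\perp)$ put $BX=\mathcal V\phi X$; and let $(\nabla F_*)(X,Y)=\nabla^F_X(F_*Y)-F_*(\nabla_XY)$ be the second fundamental form of $F$, where $\nabla^F$ is the pullback to $F^{-1}TN$ of the Levi-Civita connection of $N$. Then the following assertions are equivalent. (i) $(\ker F_*)^\perp$ is integrable, i.e. $[X,Y]\in\Gamma((\ker F_*)^\perp)$ for all $X,Y\in\Gamma((\ker F_*)^\perp)$. (ii) For all $X,Y\in\Gamma((\ker F_*)^\perp)$ and $V\in\Gamma(\ker F_*)$, $$g_N\big((\nabla F_*)(Y,BX),F_*\phi V\big)=g_N\big((\nabla F_*)(X,BY),F_*\phi V\big)+g_M(\mathcal A_X\xi,\phi\mathcal A_YV)-g_M(\mathcal A_Y\xi,\phi\mathcal A_XV).$$ (iii) For all $X,Y\in\Gamma((\ker F_*)^\perp)$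 and $V\in\Gamma(\ker F_*)$, $$g_M(\mathcal A_XBY-\mathcal A_YBX,\phi V)=g_M(\mathcal A_X\xi,\phi\mathcal A_YV)-g_M(\mathcal A_Y\xi,\phi\mathcal A_XV).$$ -/

import Mathlib

open Bundle Module
open scoped Manifold ContDiff

noncomputable section

namespace AntiInvariant

section Single

variable {E : Type*} [NormedAddCommGroup E] [NormedSpace ℝ E] [FiniteDimensional ℝ E]
  {H : Type*} [TopologicalSpace H] (I : ModelWithCorners ℝ E H)
  {M : Type*} [TopologicalSpace M] [ChartedSpace H M] [IsManifold I ∞ M]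

/-- `Γ(TM)`: the vector field `X` is smooth. -/
def IsSmoothField (X : Π x : M, TangentSpace I x) : Prop :=
  ContMDiff I I.tangent ∞ (fun x ↦ (⟨x, X x⟩ : TangentBundle I M))

/-- The tangent spaces of a finite-dimensional manifold are finite-dimensional. -/
instance finiteDimensional_tangentSpace (x : M) : FiniteDimensional ℝ (TangentSpace I x) :=
  inferInstanceAs (FiniteDimensional ℝ E)

/-- The exterior derivative of a one-form evaluated on two vector fields,
`dη(X, Y) = X(η(Y)) - Y(η(X)) - η([X, Y])`. -/
def extDeriv (η : Π x : M, TangentSpace I x →L[ℝ] ℝ) (X Y : Π x : M, TangentSpace I x)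
    (x : M) : ℝ :=
  mvfderiv I (fun y ↦ η y (Y y)) x (X x) - mvfderiv I (fun y ↦ η y (X y)) x (Y x)
    - η x (VectorField.mlieBracket I X Y x)

/-- The Nijenhuis torsion of a `(1,1)`-tensor,
`N(X, Y) = φ²[X, Y] + [φX, φY] - φ[φX, Y] - φ[X, φY]`. -/
def nijenhuis (φ : Π x : M, TangentSpace I x →L[ℝ] TangentSpace I x)
    (X Y : Π x : M, TangentSpace I x) (x : M) : TangentSpace I x :=
  φ x (φ x (VectorField.mlieBracket I X Y x))
    + VectorField.mlieBracket I (fun y ↦ φ y (X y)) (fun y ↦ φ y (Y y)) x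
    - φ x (VectorField.mlieBracket I (fun y ↦ φ y (X y)) Y x)
    - φ x (VectorField.mlieBracket I X (fun y ↦ φ y (Y y)) x)

variable [RiemannianBundle (fun x : M ↦ TangentSpace I x)]

/-- The right-hand side of the Koszul formula,
`X g(Y,Z) + Y g(X,Z) - Z g(X,Y) + g([X,Y],Z) - g([X,Z],Y) - g([Y,Z],X)`. -/
def koszul (X Y Z : Π x : M, TangentSpace I x) (x : M) : ℝ :=
  mvfderiv I (fun y ↦ inner ℝ (Y y) (Z y)) x (X x)
    + mvfderiv I (fun y ↦ inner ℝ (X y) (Z y)) x (Y x)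
    - mvfderiv I (fun y ↦ inner ℝ (X y) (Y y)) x (Z x)
    + inner ℝ (VectorField.mlieBracket I X Y x) (Z x)
    - inner ℝ (VectorField.mlieBracket I X Z x) (Y x)
    - inner ℝ (VectorField.mlieBracket I Y Z x) (X x)

/-- The Levi-Civita connection: `leviCivita I Y x v` is `(∇_v Y)(x)`, the tangent vector at `x`
determined by the Koszul formula `2 g(∇_X Y, Z) = koszul X Y Z`. It is written in an orthonormal
basis `e i` of the tangent space at `x`; `v` and the `e i` are extended to vector fields that are
smooth near `x` (the value does not depend on the extensions). -/
def leviCivita (Y : Π x : M, TangentSpace I x) (x : M) (v : TangentSpace I x) :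
    TangentSpace I x :=
  let e := stdOrthonormalBasis ℝ (TangentSpace I x)
  ∑ i, ((1 / 2 : ℝ) * koszul I (FiberBundle.extend E v) Y (FiberBundle.extend E (e i)) x) • e i

variable (M) in
/-- A Sasakian structure `(φ, ξ, η)` on a manifold with Riemannian metric `g`:
a normal contact metric structure. With `dη(X, Y) = X η(Y) - Y η(X) - η([X, Y])`, the contact
metric condition is `½ dη(X, Y) = g(X, φY)`. -/
structure SasakianStructure where
  /-- the `(1,1)`-tensor field -/
  φ : Π x : M, TangentSpace I x →L[ℝ] TangentSpace I x
  /-- the characteristic vector field -/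
  ξ : Π x : M, TangentSpace I x
  /-- the contact form -/
  η : Π x : M, TangentSpace I x →L[ℝ] ℝ
  smooth_φ : ContMDiff I (I.prod 𝓘(ℝ, E →L[ℝ] E)) ∞
    (fun x ↦ TotalSpace.mk' (E →L[ℝ] E)
      (E := fun x : M ↦ TangentSpace I x →L[ℝ] TangentSpace I x) x (φ x))
  smooth_ξ : IsSmoothField I ξ
  smooth_η : ContMDiff I (I.prod 𝓘(ℝ, E →L[ℝ] ℝ)) ∞
    (fun x ↦ TotalSpace.mk' (E →L[ℝ] ℝ)
      (E := fun x : M ↦ TangentSpace I x →L[ℝ] Bundle.Trivial M ℝ x) x (η x))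
  φ_φ : ∀ x v, φ x (φ x v) = -v + η x v • ξ x
  φ_ξ : ∀ x, φ x (ξ x) = 0
  η_φ : ∀ x v, η x (φ x v) = 0
  η_ξ : ∀ x, η x (ξ x) = 1
  metric_φ : ∀ x v w, inner ℝ (φ x v) (φ x w) = inner ℝ v w - η x v * η x w
  η_eq : ∀ x v, η x v = inner ℝ v (ξ x)
  contact : ∀ X Y, IsSmoothField I X → IsSmoothField I Y → ∀ x,
    (1 / 2 : ℝ) * extDeriv I η X Y x = inner ℝ (X x) (φ x (Y x))
  normal : ∀ X Y, IsSmoothField I X → IsSmoothField I Y → ∀ x,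
    nijenhuis I φ X Y x + extDeriv I η X Y x • ξ x = 0

end Single

section Maps

variable {E : Type*} [NormedAddCommGroup E] [NormedSpace ℝ E] [FiniteDimensional ℝ E]
  {H : Type*} [TopologicalSpace H] (I : ModelWithCorners ℝ E H)
  {M : Type*} [TopologicalSpace M] [ChartedSpace H M] [IsManifold I ∞ M]
  [RiemannianBundle (fun x : M ↦ TangentSpace I x)]
  {E' : Type*} [NormedAddCommGroup E'] [NormedSpace ℝ E'] [FiniteDimensional ℝ E']
  {H' : Type*} [TopologicalSpace H'] (J : ModelWithCorners ℝ E' H')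
  {N : Type*} [TopologicalSpace N] [ChartedSpace H' N] [IsManifold J ∞ N]

/-- The vertical space `ker F_*` at `x`. -/
def vertical (F : M → N) (x : M) : Submodule ℝ (TangentSpace I x) :=
  LinearMap.ker (mfderiv I J F x).toLinearMap

/-- The horizontal space `(ker F_*)^⊥` at `x`. -/
def horizontal (F : M → N) (x : M) : Submodule ℝ (TangentSpace I x) :=
  (vertical I J F x)ᗮ

/-- `𝒱`: the orthogonal projection onto `ker F_*`. -/
def ver (F : M → N) (x : M) : TangentSpace I x →L[ℝ] TangentSpace I x :=
  (vertical I J F x).starProjection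

/-- `ℋ`: the orthogonal projection onto `(ker F_*)^⊥`. -/
def hor (F : M → N) (x : M) : TangentSpace I x →L[ℝ] TangentSpace I x :=
  (horizontal I J F x).starProjection

/-- `Γ(ker F_*)`. -/
def IsVerticalField (F : M → N) (V : Π x : M, TangentSpace I x) : Prop :=
  IsSmoothField I V ∧ ∀ x, V x ∈ vertical I J F x

/-- `Γ((ker F_*)^⊥)`. -/
def IsHorizontalField (F : M → N) (X : Π x : M, TangentSpace I x) : Prop :=
  IsSmoothField I X ∧ ∀ x, X x ∈ horizontal I J F x

/-- The distribution `(ker F_*)^⊥` is integrable: the Lie bracket of any two of its sections is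
again one of its sections. -/
def HorizontalIntegrable (F : M → N) : Prop :=
  ∀ X Y, IsHorizontalField I J F X → IsHorizontalField I J F Y →
    ∀ x, VectorField.mlieBracket I X Y x ∈ horizontal I J F x

/-- O'Neill's tensor `𝒜_X Z = 𝒱 ∇_{ℋX} ℋZ + ℋ ∇_{ℋX} 𝒱Z`. -/
def oneillA (F : M → N) (X Z : Π x : M, TangentSpace I x) (x : M) : TangentSpace I x :=
  ver I J F x (leviCivita I (fun y ↦ hor I J F y (Z y)) x (hor I J F x (X x)))
    + hor I J F x (leviCivita I (fun y ↦ ver I J F y (Z y)) x (hor I J F x (X x)))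

/-- `BX`, the vertical part of `φX` in `φX = BX + CX`. -/
def fieldB (S : SasakianStructure I M) (F : M → N) (X : Π x : M, TangentSpace I x) (x : M) :
    TangentSpace I x :=
  ver I J F x (S.φ x (X x))

variable [RiemannianBundle (fun x : N ↦ TangentSpace J x)]

/-- A Riemannian submersion: a smooth map onto `N`, of maximal rank, whose differential preserves
the lengths of horizontal vectors. -/
structure IsRiemannianSubmersion (F : M → N) : Prop where
  smooth : ContMDiff I J ∞ F
  surjective : Function.Surjective F
  maximal_rank : ∀ x, Function.Surjective (mfderiv I J F x)
  norm_eq : ∀ x, ∀ v ∈ horizontal I J F x, ‖mfderiv I J F x v‖ = ‖v‖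

/-- `φ(ker F_*) ⊆ (ker F_*)^⊥`. -/
structure IsAntiInvariantSubmersion (S : SasakianStructure I M) (F : M → N) : Prop extends
    IsRiemannianSubmersion I J F where
  anti_invariant : ∀ x, ∀ v ∈ vertical I J F x, S.φ x v ∈ horizontal I J F x

/-- The pullback connection `∇^F` on `F⁻¹TN`, for the Levi-Civita connection of `N`.
For a section `σ = ∑ᵢ sⁱ (eᵢ ∘ F)`, where `eᵢ` is the frame of `TN` near `F x` given by a
trivialization, `∇^F_v σ = ∑ᵢ (dsⁱ(v) eᵢ + sⁱ(x) ∇_{F_* v} eᵢ)`.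
Here `y ↦ (t ⟨F y, σ y⟩).2` is the coordinate expression `(sⁱ)` of `σ`, and
`FiberBundle.extend E' (σ x)` is the field `∑ᵢ sⁱ(x) eᵢ` with constant coordinates. -/
def pullbackConnection (F : M → N) (σ : Π x : M, TangentSpace J (F x)) (x : M)
    (v : TangentSpace I x) : TangentSpace J (F x) :=
  let t := trivializationAt E' (TangentSpace J : N → Type _) (F x)
  t.symm (F x) (mvfderiv I (fun y ↦ (t ⟨F y, σ y⟩).2) x v)
    + leviCivita J (FiberBundle.extend E' (σ x)) (F x) (mfderiv I J F x v)

/-- The second fundamental form of a map,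
`(∇F_*)(X, Y) = ∇^F_X (F_* Y) - F_*(∇_X Y)`. -/
def secondFundamentalForm (F : M → N) (X Y : Π x : M, TangentSpace I x) (x : M) :
    TangentSpace J (F x) :=
  pullbackConnection I J F (fun y ↦ mfderiv I J F y (Y y)) x (X x)
    - mfderiv I J F x (leviCivita I Y x (X x))

end Maps

end AntiInvariant

end

namespace AntiInvariant

open VectorField Topology

set_option linter.unusedSectionVars false

section Calculus

variable {E : Type*} [NormedAddCommGroup E] [NormedSpace ℝ E] [FiniteDimensional ℝ E]
  {H : Type*} [TopologicalSpace H] {I : ModelWithCorners ℝ E H}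
  {M : Type*} [TopologicalSpace M] [ChartedSpace H M] [IsManifold I ∞ M]
  {X Y Z U V W : Π x : M, TangentSpace I x} {f : M → ℝ} {x : M}

lemma isManifold_minSmoothness {m : WithTop ℕ∞} [ENat.LEInfty m] :
    IsManifold I (minSmoothness ℝ m) M := by
  simpa using IsManifold.of_le (I := I) (M := M) (m := m) (n := ∞) ENat.LEInfty.out

namespace IsSmoothField

lemma contMDiffAt (hX : IsSmoothField I X) (x : M) :
    CMDiffAt ∞ (fun x ↦ (⟨x, X x⟩ : TangentBundle I M)) x :=
  ContMDiff.contMDiffAt hX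

lemma mdifferentiableAt (hX : IsSmoothField I X) (x : M) :
    MDiffAt (fun x ↦ (⟨x, X x⟩ : TangentBundle I M)) x :=
  (hX.contMDiffAt x).mdifferentiableAt (by simp)

lemma sub (hX : IsSmoothField I X) (hY : IsSmoothField I Y) :
    IsSmoothField I (fun x ↦ X x - Y x) :=
  ContMDiff.sub_section hX hY

lemma smul (hf : CMDiff ∞ f) (hX : IsSmoothField I X) : IsSmoothField I (f • X) :=
  ContMDiff.smul_section hf hX

lemma mlieBracket (hX : IsSmoothField I X) (hY : IsSmoothField I Y) :
    IsSmoothField I (mlieBracket I X Y) := by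
  have : IsManifold I (((⊤ : ℕ∞) : WithTop ℕ∞) + 1) M := by
    simpa using (inferInstance : IsManifold I ∞ M)
  have := isManifold_minSmoothness (I := I) (M := M) (m := 2)
  exact ContDiff.mlieBracket_vectorField (m := ⊤) (n := ⊤) hX hY (by simp)

lemma mvfderiv_apply (hX : IsSmoothField I X) (hf : CMDiff ∞ f) :
    CMDiff ∞ (fun y ↦ mvfderiv I f y (X y)) := by
  have h1 : ContMDiff I.tangent 𝓘(ℝ, ℝ).tangent ∞ (tangentMap I 𝓘(ℝ, ℝ) f) :=
    hf.contMDiff_tangentMap (by simp)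
  have h2 := h1.comp hX
  intro y
  have h3 := contMDiffAt_totalSpace.1 (h2 y)
  refine h3.2.congr_of_eventuallyEq (Filter.Eventually.of_forall fun z ↦ ?_)
  simp [tangentMap, mvfderiv]
  rfl

/-- Every tangent vector extends to a globally smooth vector field. -/
lemma exists_eq [T2Space M] (x : M) (v : TangentSpace I x) :
    ∃ Z : Π x : M, TangentSpace I x, IsSmoothField I Z ∧ Z x = v := by
  obtain ⟨s, hs, hsm⟩ := FiberBundle.exists_contMDiffOn_extend (k := ∞) I E (V := TangentSpace I) v
  obtain ⟨u, hus, huo, hxu⟩ := mem_nhds_iff.1 hs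
  obtain ⟨ψ, -, hψ⟩ := (SmoothBumpFunction.nhds_basis_tsupport (I := I) x).mem_iff.1
    (huo.mem_nhds hxu)
  refine ⟨(ψ : M → ℝ) • FiberBundle.extend E v,
    (ψ.contMDiff.contMDiffOn (s := u)).smul_section_of_tsupport huo hψ (hsm.mono hus), ?_⟩
  simp [Pi.smul_apply']

end IsSmoothField

/-- The Lie bracket acts on functions as the commutator of derivations; this is the Jacobi
identity for `U`, `V` and `f • W`. -/
lemma mvfderiv_mlieBracket_smul (hU : IsSmoothField I U) (hV : IsSmoothField I V)
    (hW : IsSmoothField I W) (hf : CMDiff ∞ f) (x : M) :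
    (mvfderiv I f x (mlieBracket I U V x)) • W x
      = (mvfderiv I (fun y ↦ mvfderiv I f y (V y)) x (U x)
          - mvfderiv I (fun y ↦ mvfderiv I f y (U y)) x (V x)) • W x := by
  have := isManifold_minSmoothness (I := I) (M := M) (m := 3)
  have hle : minSmoothness ℝ 2 ≤ (∞ : WithTop ℕ∞) := by
    simpa using ENat.LEInfty.out
  have hd {g : M → ℝ} (hg : CMDiff ∞ g) (y : M) : MDiffAt g y :=
    hg.contMDiffAt.mdifferentiableAt (by simp)
  have hfW := IsSmoothField.smul hf hW
  have expand {A : Π x : M, TangentSpace I x} : mlieBracket I A (f • W)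
      = (fun y ↦ mvfderiv I f y (A y)) • W + f • mlieBracket I A W :=
    funext fun y ↦ mlieBracket_smul_right (hd hf y) (hW.mdifferentiableAt y)
  have J1 := leibniz_identity_mlieBracket_apply ((hU.contMDiffAt x).of_le hle)
    ((hV.contMDiffAt x).of_le hle) ((hfW.contMDiffAt x).of_le hle)
  have J2 := leibniz_identity_mlieBracket_apply ((hU.contMDiffAt x).of_le hle)
    ((hV.contMDiffAt x).of_le hle) ((hW.contMDiffAt x).of_le hle)
  have hVf := hV.mvfderiv_apply hf
  have hUf := hU.mvfderiv_apply hf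
  have hVW := hV.mlieBracket hW
  have hUW := hU.mlieBracket hW
  rw [expand, expand, expand,
    mlieBracket_add_right ((IsSmoothField.smul hVf hW).mdifferentiableAt x)
      ((IsSmoothField.smul hf hVW).mdifferentiableAt x),
    mlieBracket_add_right ((IsSmoothField.smul hUf hW).mdifferentiableAt x)
      ((IsSmoothField.smul hf hUW).mdifferentiableAt x),
    mlieBracket_smul_right (hd hVf x) (hW.mdifferentiableAt x),
    mlieBracket_smul_right (hd hUf x) (hW.mdifferentiableAt x),
    mlieBracket_smul_right (hd hf x) (hVW.mdifferentiableAt x),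
    mlieBracket_smul_right (hd hf x) (hUW.mdifferentiableAt x)] at J1
  simp only [Pi.add_apply, Pi.smul_apply', J2] at J1
  rw [← sub_eq_zero] at J1 ⊢
  rw [← neg_eq_zero, ← J1]
  module

lemma mvfderiv_mlieBracket (hU : IsSmoothField I U) (hV : IsSmoothField I V)
    (hW : IsSmoothField I W) (hWx : W x ≠ 0) (hf : CMDiff ∞ f) :
    mvfderiv I f x (mlieBracket I U V x)
      = mvfderiv I (fun y ↦ mvfderiv I f y (V y)) x (U x)
          - mvfderiv I (fun y ↦ mvfderiv I f y (U y)) x (V x) :=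
  smul_left_injective ℝ hWx (mvfderiv_mlieBracket_smul hU hV hW hf x)

end Calculus

section LeviCivita

variable {E : Type*} [NormedAddCommGroup E] [NormedSpace ℝ E] [FiniteDimensional ℝ E]
  {H : Type*} [TopologicalSpace H] {I : ModelWithCorners ℝ E H}
  {M : Type*} [TopologicalSpace M] [ChartedSpace H M] [IsManifold I ∞ M]
  [RiemannianBundle (fun x : M ↦ TangentSpace I x)]
  {X Y Z : Π x : M, TangentSpace I x} {x : M}

lemma mvfderiv_of_eventuallyEq_zero {V : Type*} [NormedAddCommGroup V] [NormedSpace ℝ V]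
    {f : M → V} (hf : f =ᶠ[𝓝 x] fun _ ↦ 0) : mvfderiv I f x = 0 := by
  rw [mvfderiv, hf.mfderiv_eq, mfderiv_const]
  rfl

lemma leviCivita_of_eventuallyEq_zero (hY : ∀ᶠ y in 𝓝 x, Y y = 0) (v : TangentSpace I x) :
    leviCivita I Y x v = 0 := by
  have hY' : Y =ᶠ[𝓝 x] (0 : Π y : M, TangentSpace I y) := hY
  have h₁ (Z : Π x : M, TangentSpace I x) : mvfderiv I (fun y ↦ inner ℝ (Y y) (Z y)) x = 0 :=
    mvfderiv_of_eventuallyEq_zero (hY.mono fun y hy ↦ by simp only [hy, inner_zero_left])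
  have h₂ (Z : Π x : M, TangentSpace I x) : mvfderiv I (fun y ↦ inner ℝ (Z y) (Y y)) x = 0 :=
    mvfderiv_of_eventuallyEq_zero (hY.mono fun y hy ↦ by simp only [hy, inner_zero_right])
  have h₃ (Z : Π x : M, TangentSpace I x) : mlieBracket I Y Z x = 0 := by
    rw [hY'.mlieBracket_vectorField_eq (Filter.EventuallyEq.refl _ Z), mlieBracket_zero_left]
    rfl
  have h₄ (Z : Π x : M, TangentSpace I x) : mlieBracket I Z Y x = 0 := by
    rw [mlieBracket_swap_apply, h₃, neg_zero]
  simp only [leviCivita, koszul, h₁, h₂, h₃, h₄, hY.self_of_nhds, map_zero, inner_zero_left,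
    inner_zero_right, zero_apply, add_zero, sub_zero, mul_zero, zero_smul, Finset.sum_const_zero]

lemma leviCivita_zero_field (x : M) (v : TangentSpace I x) :
    leviCivita I (fun y ↦ (0 : TangentSpace I y)) x v = 0 :=
  leviCivita_of_eventuallyEq_zero (Filter.Eventually.of_forall fun _ ↦ rfl) v

lemma koszul_add_koszul_swap (X Y Z : Π x : M, TangentSpace I x) (x : M) :
    koszul I X Y Z x + koszul I X Z Y x
      = 2 * mvfderiv I (fun y ↦ inner ℝ (Y y) (Z y)) x (X x) := by
  simp only [koszul, mlieBracket_swap_apply (V := Z) (W := Y), inner_neg_left]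
  simp only [real_inner_comm (Z _) (Y _)]
  ring

lemma koszul_sub_koszul_swap (X Y Z : Π x : M, TangentSpace I x) (x : M) :
    koszul I X Y Z x - koszul I Y X Z x
      = 2 * inner ℝ (mlieBracket I X Y x) (Z x) := by
  simp only [koszul, mlieBracket_swap_apply (V := Y) (W := X), inner_neg_left]
  simp only [real_inner_comm (Y _) (X _)]
  ring

variable [IsContMDiffRiemannianBundle I ∞ E (fun x : M ↦ TangentSpace I x)]

lemma IsSmoothField.inner (hX : IsSmoothField I X) (hY : IsSmoothField I Y) :
    CMDiff ∞ (fun y ↦ inner ℝ (X y) (Y y)) :=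
  ContMDiff.inner_bundle (F := E) (E := fun x : M ↦ TangentSpace I x) hX hY

lemma mdifferentiableAt_inner
    (hX : MDiffAt (fun x ↦ (⟨x, X x⟩ : TangentBundle I M)) x)
    (hY : MDiffAt (fun x ↦ (⟨x, Y x⟩ : TangentBundle I M)) x) :
    MDiffAt (fun y ↦ inner ℝ (X y) (Y y)) x :=
  have : IsContMDiffRiemannianBundle I 1 E (fun x : M ↦ TangentSpace I x) :=
    IsContMDiffRiemannianBundle.of_le (n := ∞) (by simp)
  MDifferentiableAt.inner_bundle (F := E) (E := fun x : M ↦ TangentSpace I x) hX hY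

lemma tensorialAt_koszul_left (hY : MDiffAt (fun x ↦ (⟨x, Y x⟩ : TangentBundle I M)) x)
    (hZ : MDiffAt (fun x ↦ (⟨x, Z x⟩ : TangentBundle I M)) x) :
    TensorialAt I E (V := fun x : M ↦ TangentSpace I x) (koszul I · Y Z x) x where
  smul {f σ} hf hσ := by
    have e1 : (fun y ↦ inner ℝ ((f • σ) y) (Z y)) = f * fun y ↦ inner ℝ (σ y) (Z y) := by
      ext y; simp [real_inner_smul_left]
    have e2 : (fun y ↦ inner ℝ ((f • σ) y) (Y y)) = f * fun y ↦ inner ℝ (σ y) (Y y) := by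
      ext y; simp [real_inner_smul_left]
    simp only [koszul]
    rw [e1, e2, mvfderiv_mul hf (mdifferentiableAt_inner hσ hZ),
      mvfderiv_mul hf (mdifferentiableAt_inner hσ hY), mlieBracket_smul_left hf hσ,
      mlieBracket_smul_left hf hσ]
    simp only [Pi.smul_apply', map_smul, add_apply,
      smul_apply, smul_eq_mul, inner_add_left, real_inner_smul_left,
      real_inner_smul_right]
    ring
  add {σ τ} hσ hτ := by
    have e1 : (fun y ↦ inner ℝ ((σ + τ) y) (Z y))
        = (fun y ↦ inner ℝ (σ y) (Z y)) + fun y ↦ inner ℝ (τ y) (Z y) := by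
      ext y; simp [inner_add_left]
    have e2 : (fun y ↦ inner ℝ ((σ + τ) y) (Y y))
        = (fun y ↦ inner ℝ (σ y) (Y y)) + fun y ↦ inner ℝ (τ y) (Y y) := by
      ext y; simp [inner_add_left]
    simp only [koszul]
    rw [e1, e2, mvfderiv_add (mdifferentiableAt_inner hσ hZ) (mdifferentiableAt_inner hτ hZ),
      mvfderiv_add (mdifferentiableAt_inner hσ hY) (mdifferentiableAt_inner hτ hY),
      mlieBracket_add_left hσ hτ, mlieBracket_add_left hσ hτ]
    simp only [Pi.add_apply, map_add, add_apply, inner_add_left,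
      inner_add_right]
    ring

lemma tensorialAt_koszul_right (hX : MDiffAt (fun x ↦ (⟨x, X x⟩ : TangentBundle I M)) x)
    (hY : MDiffAt (fun x ↦ (⟨x, Y x⟩ : TangentBundle I M)) x) :
    TensorialAt I E (V := fun x : M ↦ TangentSpace I x) (koszul I X Y · x) x where
  smul {f σ} hf hσ := by
    have e1 : (fun y ↦ inner ℝ (X y) ((f • σ) y)) = f * fun y ↦ inner ℝ (X y) (σ y) := by
      ext y; simp [real_inner_smul_right]
    have e2 : (fun y ↦ inner ℝ (Y y) ((f • σ) y)) = f * fun y ↦ inner ℝ (Y y) (σ y) := by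
      ext y; simp [real_inner_smul_right]
    simp only [koszul]
    rw [e1, e2, mvfderiv_mul hf (mdifferentiableAt_inner hX hσ),
      mvfderiv_mul hf (mdifferentiableAt_inner hY hσ), mlieBracket_smul_right hf hσ,
      mlieBracket_smul_right hf hσ]
    simp only [Pi.smul_apply', map_smul, add_apply,
      smul_apply, smul_eq_mul, inner_add_left, real_inner_smul_left,
      real_inner_smul_right, real_inner_comm (σ x)]
    ring
  add {σ τ} hσ hτ := by
    have e1 : (fun y ↦ inner ℝ (X y) ((σ + τ) y))
        = (fun y ↦ inner ℝ (X y) (σ y)) + fun y ↦ inner ℝ (X y) (τ y) := by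
      ext y; simp [inner_add_right]
    have e2 : (fun y ↦ inner ℝ (Y y) ((σ + τ) y))
        = (fun y ↦ inner ℝ (Y y) (σ y)) + fun y ↦ inner ℝ (Y y) (τ y) := by
      ext y; simp [inner_add_right]
    simp only [koszul]
    rw [e1, e2, mvfderiv_add (mdifferentiableAt_inner hX hσ) (mdifferentiableAt_inner hX hτ),
      mvfderiv_add (mdifferentiableAt_inner hY hσ) (mdifferentiableAt_inner hY hτ),
      mlieBracket_add_right hσ hτ, mlieBracket_add_right hσ hτ]
    simp only [Pi.add_apply, map_add, add_apply, inner_add_left,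
      inner_add_right]
    ring

/-- The Koszul formula. -/
lemma inner_leviCivita (hX : MDiffAt (fun x ↦ (⟨x, X x⟩ : TangentBundle I M)) x)
    (hY : MDiffAt (fun x ↦ (⟨x, Y x⟩ : TangentBundle I M)) x)
    (hZ : MDiffAt (fun x ↦ (⟨x, Z x⟩ : TangentBundle I M)) x) :
    inner ℝ (leviCivita I Y x (X x)) (Z x) = (1 / 2 : ℝ) * koszul I X Y Z x := by
  have hv : MDiffAt
      (fun y ↦ (⟨y, FiberBundle.extend E (X x) y⟩ : TangentBundle I M)) x :=
    FiberBundle.mdifferentiableAt_extend I E (X x)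
  have hR := tensorialAt_koszul_right hv hY
  let e := stdOrthonormalBasis ℝ (TangentSpace I x)
  have hLZ : TensorialAt.mkHom _ x hR (Z x) = koszul I X Y Z x :=
    (TensorialAt.mkHom_apply hR hZ).trans
      ((tensorialAt_koszul_left hY hZ).pointwise hv hX (by simp))
  rw [← hLZ]
  conv_rhs => rw [← e.sum_repr' (Z x)]
  simp only [leviCivita, sum_inner, map_sum, map_smul, real_inner_smul_left, Finset.mul_sum,
    smul_eq_mul, TensorialAt.mkHom_apply_eq_extend]
  exact Finset.sum_congr rfl fun i _ ↦ by ring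

/-- The Levi-Civita connection is metric. -/
lemma mvfderiv_inner (hX : IsSmoothField I X) (hY : IsSmoothField I Y) (hZ : IsSmoothField I Z)
    (x : M) :
    mvfderiv I (fun y ↦ inner ℝ (Y y) (Z y)) x (X x)
      = inner ℝ (leviCivita I Y x (X x)) (Z x) + inner ℝ (Y x) (leviCivita I Z x (X x)) := by
  rw [real_inner_comm _ (Y x),
    inner_leviCivita (hX.mdifferentiableAt x) (hY.mdifferentiableAt x) (hZ.mdifferentiableAt x),
    inner_leviCivita (hX.mdifferentiableAt x) (hZ.mdifferentiableAt x) (hY.mdifferentiableAt x)]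
  linear_combination -(1 / 2 : ℝ) * koszul_add_koszul_swap X Y Z x

/-- The Levi-Civita connection is torsion-free. -/
lemma inner_mlieBracket (hX : IsSmoothField I X) (hY : IsSmoothField I Y) (hZ : IsSmoothField I Z)
    (x : M) :
    inner ℝ (mlieBracket I X Y x) (Z x)
      = inner ℝ (leviCivita I Y x (X x)) (Z x) - inner ℝ (leviCivita I X x (Y x)) (Z x) := by
  rw [inner_leviCivita (hX.mdifferentiableAt x) (hY.mdifferentiableAt x) (hZ.mdifferentiableAt x),
    inner_leviCivita (hY.mdifferentiableAt x) (hX.mdifferentiableAt x) (hZ.mdifferentiableAt x)]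
  linear_combination -(1 / 2 : ℝ) * koszul_sub_koszul_swap X Y Z x

end LeviCivita

section Sasakian

variable {E : Type*} [NormedAddCommGroup E] [NormedSpace ℝ E] [FiniteDimensional ℝ E]
  {H : Type*} [TopologicalSpace H] {I : ModelWithCorners ℝ E H}
  {M : Type*} [TopologicalSpace M] [ChartedSpace H M] [IsManifold I ∞ M]
  [RiemannianBundle (fun x : M ↦ TangentSpace I x)]
  {X Y Z : Π x : M, TangentSpace I x}

namespace SasakianStructure

variable (S : SasakianStructure I M)

lemma isSmoothField_φ (hX : IsSmoothField I X) : IsSmoothField I (fun y ↦ S.φ y (X y)) :=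
  ContMDiff.clm_bundle_apply (F₁ := E) (F₂ := E) (E₁ := fun x : M ↦ TangentSpace I x)
    (E₂ := fun x : M ↦ TangentSpace I x) (b := id) S.smooth_φ hX

lemma contMDiff_η (hX : IsSmoothField I X) : CMDiff ∞ (fun y ↦ S.η y (X y)) := by
  have h := ContMDiff.clm_bundle_apply (F₁ := E) (F₂ := ℝ) (E₁ := fun x : M ↦ TangentSpace I x)
    (E₂ := Bundle.Trivial M ℝ) (b := id) S.smooth_η hX
  exact fun y ↦ (contMDiffAt_totalSpace.1 (h y)).2

lemma inner_φ_left (x : M) (v w : TangentSpace I x) :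
    inner ℝ (S.φ x v) w = -inner ℝ v (S.φ x w) := by
  have h := S.metric_φ x v (S.φ x w)
  rw [S.φ_φ, S.η_φ, inner_add_right, inner_neg_right, real_inner_smul_right, ← S.η_eq, S.η_φ] at h
  linarith

lemma inner_ξ_φ (x : M) (v : TangentSpace I x) : inner ℝ (S.ξ x) (S.φ x v) = 0 := by
  rw [real_inner_comm, ← S.η_eq, S.η_φ]

lemma ξ_ne_zero (x : M) : S.ξ x ≠ 0 := fun h ↦ by
  have := S.η_ξ x
  simp [h] at this

lemma mvfderiv_mlieBracket (S : SasakianStructure I M) (hX : IsSmoothField I X) (hY : IsSmoothField I Y) {f : M → ℝ}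
    (hf : CMDiff ∞ f) (x : M) :
    mvfderiv I f x (mlieBracket I X Y x)
      = mvfderiv I (fun y ↦ mvfderiv I f y (Y y)) x (X x)
          - mvfderiv I (fun y ↦ mvfderiv I f y (X y)) x (Y x) :=
  AntiInvariant.mvfderiv_mlieBracket hX hY S.smooth_ξ (S.ξ_ne_zero x) hf

lemma mvfderiv_extDeriv (hX : IsSmoothField I X) (hY : IsSmoothField I Y) (x : M)
    (v : TangentSpace I x) :
    mvfderiv I (extDeriv I S.η X Y) x v
      = mvfderiv I (fun y ↦ mvfderiv I (fun z ↦ S.η z (Y z)) y (X y)) x v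
        - mvfderiv I (fun y ↦ mvfderiv I (fun z ↦ S.η z (X z)) y (Y y)) x v
        - mvfderiv I (fun y ↦ S.η y (mlieBracket I X Y y)) x v := by
  have hd {g : M → ℝ} (hg : CMDiff ∞ g) : MDiffAt g x := hg.contMDiffAt.mdifferentiableAt (by simp)
  have h1 := hd (hX.mvfderiv_apply (S.contMDiff_η hY))
  have h2 := hd (hY.mvfderiv_apply (S.contMDiff_η hX))
  have h3 := hd (S.contMDiff_η (hX.mlieBracket hY))
  have e : extDeriv I S.η X Y = (fun y ↦ mvfderiv I (fun z ↦ S.η z (Y z)) y (X y))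
      - (fun y ↦ mvfderiv I (fun z ↦ S.η z (X z)) y (Y y))
      - (fun y ↦ S.η y (mlieBracket I X Y y)) := rfl
  rw [e, mvfderiv_sub (h1.sub h2) h3, mvfderiv_sub h1 h2]
  rfl

/-- `ddη = 0`. -/
lemma extDeriv_extDeriv (hX : IsSmoothField I X) (hY : IsSmoothField I Y)
    (hZ : IsSmoothField I Z) (x : M) :
    mvfderiv I (extDeriv I S.η Y Z) x (X x) + mvfderiv I (extDeriv I S.η Z X) x (Y x)
      + mvfderiv I (extDeriv I S.η X Y) x (Z x)
      - extDeriv I S.η (mlieBracket I X Y) Z x - extDeriv I S.η (mlieBracket I Y Z) X x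
      - extDeriv I S.η (mlieBracket I Z X) Y x = 0 := by
  have := isManifold_minSmoothness (I := I) (M := M) (m := 3)
  have hle : minSmoothness ℝ 2 ≤ (∞ : WithTop ℕ∞) := by
    simpa using ENat.LEInfty.out
  have J := leibniz_identity_mlieBracket_apply ((hX.contMDiffAt x).of_le hle)
    ((hY.contMDiffAt x).of_le hle) ((hZ.contMDiffAt x).of_le hle)
  have J' := congrArg (S.η x) J
  rw [map_add, mlieBracket_swap_apply (V := X) (W := mlieBracket I Y Z),
    mlieBracket_swap_apply (V := Y) (W := mlieBracket I X Z),
    mlieBracket_swap (V := X) (W := Z)] at J'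
  have e : mlieBracket I (-mlieBracket I Z X) Y x = - mlieBracket I (mlieBracket I Z X) Y x := by
    simpa using mlieBracket_const_smul_left (c := (-1 : ℝ)) (W := Y)
      ((hZ.mlieBracket hX).mdifferentiableAt x)
  rw [e, map_neg, map_neg, map_neg, neg_neg] at J'
  rw [S.mvfderiv_extDeriv hY hZ, S.mvfderiv_extDeriv hZ hX, S.mvfderiv_extDeriv hX hY]
  simp only [extDeriv]
  rw [S.mvfderiv_mlieBracket hX hY (S.contMDiff_η hZ),
    S.mvfderiv_mlieBracket hY hZ (S.contMDiff_η hX),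
    S.mvfderiv_mlieBracket hZ hX (S.contMDiff_η hY)]
  linear_combination -J'

/-- The fundamental two-form `Φ(X, Y) = g(X, φY)` is closed. -/
lemma fundamentalForm_closed (hX : IsSmoothField I X) (hY : IsSmoothField I Y)
    (hZ : IsSmoothField I Z) (x : M) :
    mvfderiv I (fun y ↦ inner ℝ (Y y) (S.φ y (Z y))) x (X x)
      + mvfderiv I (fun y ↦ inner ℝ (Z y) (S.φ y (X y))) x (Y x)
      + mvfderiv I (fun y ↦ inner ℝ (X y) (S.φ y (Y y))) x (Z x)
      - inner ℝ (mlieBracket I X Y x) (S.φ x (Z x)) - inner ℝ (mlieBracket I Y Z x) (S.φ x (X x))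
      - inner ℝ (mlieBracket I Z X x) (S.φ x (Y x)) = 0 := by
  have key {U V : Π x : M, TangentSpace I x} (hU : IsSmoothField I U) (hV : IsSmoothField I V)
      (v : TangentSpace I x) : mvfderiv I (fun y ↦ inner ℝ (U y) (S.φ y (V y))) x v
        = (1 / 2 : ℝ) * mvfderiv I (extDeriv I S.η U V) x v := by
    have hd {g : M → ℝ} (hg : CMDiff ∞ g) : MDiffAt g x :=
      hg.contMDiffAt.mdifferentiableAt (by simp)
    have hs : CMDiff ∞ (extDeriv I S.η U V) :=
      ((hU.mvfderiv_apply (S.contMDiff_η hV)).sub (hV.mvfderiv_apply (S.contMDiff_η hU))).sub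
        (S.contMDiff_η (hU.mlieBracket hV))
    have e : (fun y ↦ inner ℝ (U y) (S.φ y (V y)))
        = (fun _ ↦ (1 / 2 : ℝ)) * extDeriv I S.η U V :=
      funext fun y ↦ (S.contact U V hU hV y).symm
    rw [e, mvfderiv_mul (mdifferentiable_const ..) (hd hs), mvfderiv_const]
    simp
  rw [key hY hZ, key hZ hX, key hX hY, ← S.contact _ _ (hX.mlieBracket hY) hZ,
    ← S.contact _ _ (hY.mlieBracket hZ) hX, ← S.contact _ _ (hZ.mlieBracket hX) hY]
  linear_combination (1 / 2 : ℝ) * S.extDeriv_extDeriv hX hY hZ x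

variable [IsContMDiffRiemannianBundle I ∞ E (fun x : M ↦ TangentSpace I x)]

/-- `(∇_X φ)Y = g(X, Y)ξ - η(Y)X`, paired with `Z`. -/
lemma inner_leviCivita_φ (hX : IsSmoothField I X) (hY : IsSmoothField I Y)
    (hZ : IsSmoothField I Z) (x : M) :
    inner ℝ (leviCivita I (fun y ↦ S.φ y (Y y)) x (X x)) (Z x)
      = inner ℝ (S.φ x (leviCivita I Y x (X x))) (Z x)
        + inner ℝ (X x) (Y x) * S.η x (Z x) - S.η x (Y x) * inner ℝ (X x) (Z x) := by
  have hd {g : M → ℝ} (hg : CMDiff ∞ g) : MDiffAt g x := hg.contMDiffAt.mdifferentiableAt (by simp)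
  have hφY := S.isSmoothField_φ hY
  have hφZ := S.isSmoothField_φ hZ
  have hηX := hd (S.contMDiff_η hX)
  have hηY := hd (S.contMDiff_η hY)
  have hηZ := hd (S.contMDiff_η hZ)
  have d₁ := S.fundamentalForm_closed hX hY hZ x
  have d₂ := S.fundamentalForm_closed hX hφY hφZ x
  have f₁ : (fun y ↦ inner ℝ (Z y) (S.φ y (X y))) = -fun y ↦ inner ℝ (X y) (S.φ y (Z y)) := by
    ext y; rw [real_inner_comm, S.inner_φ_left]; rfl
  have f₂ : (fun y ↦ inner ℝ (S.φ y (Y y)) (S.φ y (S.φ y (Z y))))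
      = fun y ↦ inner ℝ (Y y) (S.φ y (Z y)) := by
    ext y; rw [S.metric_φ, S.η_φ]; ring
  have f₃ : (fun y ↦ inner ℝ (S.φ y (Z y)) (S.φ y (X y)))
      = (fun y ↦ inner ℝ (X y) (Z y)) - (fun y ↦ S.η y (X y)) * fun y ↦ S.η y (Z y) := by
    ext y; simp [S.metric_φ, real_inner_comm (Z y), mul_comm]
  have f₄ : (fun y ↦ inner ℝ (X y) (S.φ y (S.φ y (Y y))))
      = (fun y ↦ S.η y (X y)) * (fun y ↦ S.η y (Y y)) - fun y ↦ inner ℝ (X y) (Y y) := by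
    ext y
    rw [S.φ_φ, inner_add_right, inner_neg_right, real_inner_smul_right, ← S.η_eq]
    simp; ring
  have f₅ : (fun y ↦ inner ℝ (S.φ y (Y y)) (Z y)) = -fun y ↦ inner ℝ (Y y) (S.φ y (Z y)) := by
    ext y; rw [S.inner_φ_left]; rfl
  have f₆ (W : Π x : M, TangentSpace I x) : (fun y ↦ S.η y (S.φ y (W y))) = fun _ ↦ (0 : ℝ) := by
    ext y; rw [S.η_φ]
  have gφφ (v w : TangentSpace I x) :
      inner ℝ v (S.φ x (S.φ x w)) = S.η x v * S.η x w - inner ℝ v w := by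
    rw [S.φ_φ, inner_add_right, inner_neg_right, real_inner_smul_right, ← S.η_eq]; ring
  rw [f₁, mvfderiv_neg] at d₁
  rw [f₂, f₃, f₄, mvfderiv_sub (hd (hX.inner hZ)) (hηX.mul hηZ), mvfderiv_mul hηX hηZ,
    mvfderiv_sub (hηX.mul hηY) (hd (hX.inner hY)), mvfderiv_mul hηX hηY, gφφ, gφφ] at d₂
  have n := congrArg (fun v ↦ inner ℝ v (S.φ x (X x))) (S.normal Y Z hY hZ x)
  simp only [nijenhuis, inner_add_left, inner_sub_left, real_inner_smul_left, S.inner_ξ_φ,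
    inner_zero_left, S.metric_φ, S.η_φ] at n
  rw [S.inner_φ_left] at n
  have c₁ := S.contact _ _ hφY hZ x
  have c₂ := S.contact _ _ hY hφZ x
  have c₃ := S.contact _ _ hφY hX x
  have c₄ := S.contact _ _ hφZ hX x
  simp only [extDeriv, f₆, mvfderiv_const, S.metric_φ, gφφ] at c₁ c₂ c₃ c₄
  rw [S.inner_φ_left x (leviCivita I Y x (X x)),
    inner_leviCivita (hX.mdifferentiableAt x) (hφY.mdifferentiableAt x) (hZ.mdifferentiableAt x),
    ← sub_eq_zero]
  have k := inner_leviCivita (hX.mdifferentiableAt x) (hY.mdifferentiableAt x)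
    (hφZ.mdifferentiableAt x)
  rw [k]
  simp only [koszul]
  rw [f₅, mvfderiv_neg]
  have b₁ : mlieBracket I Z X x = -mlieBracket I X Z x := mlieBracket_swap_apply
  have b₂ : mlieBracket I (fun y ↦ S.φ y (Z y)) X x
    = -mlieBracket I X (fun y ↦ S.φ y (Z y)) x := mlieBracket_swap_apply
  have b₃ : mlieBracket I (fun y ↦ S.φ y (Y y)) X x
    = -mlieBracket I X (fun y ↦ S.φ y (Y y)) x := mlieBracket_swap_apply
  rw [b₁] at d₁
  rw [b₂] at d₂ c₄
  rw [b₃] at c₃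
  simp only [map_neg, inner_neg_left, neg_apply, sub_apply, add_apply, smul_apply, smul_eq_mul,
    zero_apply] at *
  have s₁ := real_inner_comm (X x) (Y x)
  have s₂ := real_inner_comm (X x) (Z x)
  linear_combination (1 / 2 : ℝ) * (d₂ - d₁ + n)
    + S.η x (Z x) * (c₃ + s₁) - S.η x (Y x) * (c₄ + s₂) + S.η x (X x) * (c₁ + c₂)

/-- `∇_X ξ = -φX`. -/
lemma leviCivita_ξ [T2Space M] (hX : IsSmoothField I X) (x : M) :
    leviCivita I S.ξ x (X x) = -S.φ x (X x) := by
  refine ext_inner_right ℝ fun w ↦ ?_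
  obtain ⟨Z, hZ, rfl⟩ := IsSmoothField.exists_eq (I := I) x w
  have h := S.inner_leviCivita_φ hX S.smooth_ξ (S.isSmoothField_φ hZ) x
  have m := mvfderiv_inner hX S.smooth_ξ S.smooth_ξ x
  have e : (fun y ↦ inner ℝ (S.ξ y) (S.ξ y)) = fun _ ↦ (1 : ℝ) := by
    ext y; rw [← S.η_eq, S.η_ξ]
  rw [e, mvfderiv_const, real_inner_comm (leviCivita I S.ξ x (X x)), ← S.η_eq] at m
  simp only [S.φ_ξ, leviCivita_zero_field, inner_zero_left, S.metric_φ, S.η_φ, S.η_ξ,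
    zero_apply] at h m
  rw [inner_neg_left, S.inner_φ_left]
  linear_combination -h - (1 / 2 : ℝ) * S.η x (Z x) * m

end SasakianStructure

end Sasakian

section Projection

variable {E : Type*} [NormedAddCommGroup E] [NormedSpace ℝ E] [FiniteDimensional ℝ E]
  {H : Type*} [TopologicalSpace H] {I : ModelWithCorners ℝ E H}
  {M : Type*} [TopologicalSpace M] [ChartedSpace H M] [IsManifold I ∞ M]
  [RiemannianBundle (fun x : M ↦ TangentSpace I x)]
  {X Y Z U V : Π x : M, TangentSpace I x}

/-- The solution of a linear system with smooth invertible matrix and smooth right-hand side is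
smooth. -/
lemma contMDiffAt_of_sum_mul {ι : Type*} [Fintype ι] [DecidableEq ι] {G : ι → ι → M → ℝ}
    {c : ι → M → ℝ} {x : M} (hG : ∀ i j, CMDiffAt ∞ (G i j) x)
    (hr : ∀ j, CMDiffAt ∞ (fun y ↦ ∑ i, c i y * G i j y) x)
    (hinj : ∀ u : ι → ℝ, (∀ j, ∑ i, u i * G i j x = 0) → u = 0) (i : ι) :
    CMDiffAt ∞ (c i) x := by
  let T (i j : ι) : (ι → ℝ) →L[ℝ] (ι → ℝ) :=
    (ContinuousLinearMap.proj i).smulRight (Pi.single j (1 : ℝ))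
  let A (y : M) : (ι → ℝ) →L[ℝ] (ι → ℝ) := ∑ i, ∑ j, G i j y • T i j
  have hA_apply (y : M) (u : ι → ℝ) (j : ι) : A y u j = ∑ i, u i * G i j y := by
    simp [A, T, Pi.single_apply, mul_comm]
  have hA : CMDiffAt ∞ A x :=
    ContMDiffAt.sum fun i _ ↦ ContMDiffAt.sum fun j _ ↦ (hG i j).smul contMDiffAt_const
  have hker : Function.Injective (A x).toLinearMap := by
    refine (injective_iff_map_eq_zero _).2 fun u hu ↦ hinj u fun j ↦ ?_
    rw [← hA_apply]
    exact congrFun hu j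
  let e : (ι → ℝ) ≃L[ℝ] (ι → ℝ) :=
    (LinearEquiv.ofInjectiveEndo _ hker).toContinuousLinearEquiv
  have he : (e : (ι → ℝ) →L[ℝ] (ι → ℝ)) = A x := by
    ext u; rfl
  have hinv : CMDiffAt ∞ (fun y ↦ (A y).inverse) x := by
    have h := contDiffAt_map_inverse (𝕜 := ℝ) (n := ∞) e
    rw [he] at h
    exact h.contMDiffAt.comp x hA
  have hr' : ContMDiffAt I 𝓘(ℝ, ι → ℝ) ∞ (fun y ↦ fun j ↦ ∑ i, c i y * G i j y) x :=
    contMDiffAt_pi_space.2 hr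
  have hev : ∀ᶠ y in 𝓝 x, (A y).inverse (fun j ↦ ∑ i, c i y * G i j y) = fun i ↦ c i y := by
    have hn := ContinuousLinearEquiv.nhds e
    rw [he] at hn
    filter_upwards [hA.continuousAt.preimage_mem_nhds hn] with y hy
    obtain ⟨e', he'⟩ := hy
    have : (fun j ↦ ∑ i, c i y * G i j y) = A y (fun i ↦ c i y) := by
      ext j; rw [hA_apply]
    rw [this, ← he', ContinuousLinearMap.inverse_equiv]
    simp
  have := (hinv.clm_apply hr').congr_of_eventuallyEq
    (hev.mono fun y hy ↦ hy.symm)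
  exact contMDiffAt_pi_space.1 this i

variable [IsContMDiffRiemannianBundle I ∞ E (fun x : M ↦ TangentSpace I x)]

/-- A vector field is smooth if its inner products with local smooth fields are smooth. -/
lemma isSmoothField_of_inner
    (h : ∀ (x : M) (W : Π x : M, TangentSpace I x),
      CMDiffAt ∞ (fun y ↦ (⟨y, W y⟩ : TangentBundle I M)) x →
      CMDiffAt ∞ (fun y ↦ inner ℝ (U y) (W y)) x) : IsSmoothField I U := by
  classical
  intro x
  let t := trivializationAt E (fun x : M ↦ TangentSpace I x) x
  have hx : x ∈ t.baseSet := FiberBundle.mem_baseSet_trivializationAt E _ x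
  let b := Module.finBasis ℝ E
  have hs (i) : CMDiffAt ∞ (fun y ↦ (⟨y, t.localFrame b i y⟩ : TangentBundle I M)) x :=
    contMDiffAt_localFrame_of_mem ∞ t b i hx
  refine (contMDiffAt_iff_localFrameCoeff (I := I) (F := E) (V := fun x : M ↦ TangentSpace I x)
    (e := t) b hx).2 fun i ↦ ?_
  have hsum (y : M) (hy : y ∈ t.baseSet) :
      U y = ∑ i, t.localFrameCoeff I b i y (U y) • t.localFrame b i y :=
    t.eq_sum_localFrameCoeff_smul hy
  refine contMDiffAt_of_sum_mul
    (G := fun i j y ↦ inner ℝ (t.localFrame b i y) (t.localFrame b j y))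
    (c := fun i y ↦ t.localFrameCoeff I b i y (U y))
    (fun i j ↦ ContMDiffAt.inner_bundle (F := E) (E := fun x : M ↦ TangentSpace I x)
      (hs i) (hs j)) (fun j ↦ ?_) (fun u hu ↦ ?_) i
  · refine (h x _ (hs j)).congr_of_eventuallyEq ?_
    filter_upwards [t.open_baseSet.mem_nhds hx] with y hy
    conv_rhs => rw [hsum y hy]
    simp [sum_inner, real_inner_smul_left]
  · have hz : ∑ i, u i • t.localFrame b i x = 0 := by
      have h0 : inner ℝ (∑ i, u i • t.localFrame b i x) (∑ i, u i • t.localFrame b i x) = 0 := by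
        rw [inner_sum]
        refine Finset.sum_eq_zero fun j _ ↦ ?_
        rw [real_inner_smul_right, sum_inner]
        simp only [real_inner_smul_left]
        rw [hu j, mul_zero]
      exact inner_self_eq_zero.1 h0
    exact funext (Fintype.linearIndependent_iff.1
      ((t.isLocalFrameOn_localFrame_baseSet I 1 b).linearIndependent hx) u hz)

variable {E' : Type*} [NormedAddCommGroup E'] [NormedSpace ℝ E'] [FiniteDimensional ℝ E']
  {H' : Type*} [TopologicalSpace H'] {J : ModelWithCorners ℝ E' H'}
  {N : Type*} [TopologicalSpace N] [ChartedSpace H' N] [IsManifold J ∞ N]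
  {F : M → N} {x : M}

lemma hor_mem (F : M → N) (x : M) (v : TangentSpace I x) : hor I J F x v ∈ horizontal I J F x :=
  Submodule.starProjection_apply_mem ..

lemma ver_mem (F : M → N) (x : M) (v : TangentSpace I x) : ver I J F x v ∈ vertical I J F x :=
  Submodule.starProjection_apply_mem ..

lemma ver_add_hor (F : M → N) (x : M) (v : TangentSpace I x) :
    ver I J F x v + hor I J F x v = v :=
  (vertical I J F x).starProjection_add_starProjection_orthogonal v

lemma hor_of_horizontal {v : TangentSpace I x} (hv : v ∈ horizontal I J F x) :
    hor I J F x v = v :=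
  Submodule.starProjection_eq_self_iff.2 hv

lemma ver_of_vertical {v : TangentSpace I x} (hv : v ∈ vertical I J F x) :
    ver I J F x v = v :=
  Submodule.starProjection_eq_self_iff.2 hv

lemma hor_of_vertical {v : TangentSpace I x} (hv : v ∈ vertical I J F x) :
    hor I J F x v = 0 := by
  simpa [ver_of_vertical hv] using ver_add_hor (J := J) F x v

lemma inner_of_vertical_horizontal {v w : TangentSpace I x} (hv : v ∈ vertical I J F x)
    (hw : w ∈ horizontal I J F x) : inner ℝ v w = 0 :=
  (Submodule.mem_orthogonal _ _).1 hw v hv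

lemma inner_hor_left (v w : TangentSpace I x) :
    inner ℝ (hor I J F x v) w = inner ℝ v (hor I J F x w) :=
  Submodule.inner_starProjection_left_eq_right ..

lemma mfderiv_of_vertical {v : TangentSpace I x} (hv : v ∈ vertical I J F x) :
    mfderiv I J F x v = 0 :=
  hv

lemma mfderiv_hor (v : TangentSpace I x) :
    mfderiv I J F x (hor I J F x v) = mfderiv I J F x v := by
  conv_rhs => rw [← ver_add_hor (J := J) F x v, map_add, mfderiv_of_vertical (ver_mem F x v),
    zero_add]

variable [RiemannianBundle (fun x : N ↦ TangentSpace J x)]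

namespace IsRiemannianSubmersion

lemma inner_mfderiv (hF : IsRiemannianSubmersion I J F) {v w : TangentSpace I x}
    (hv : v ∈ horizontal I J F x) (hw : w ∈ horizontal I J F x) :
    inner ℝ (mfderiv I J F x v) (mfderiv I J F x w) = inner ℝ v w := by
  have h₁ := hF.norm_eq x _ hv
  have h₂ := hF.norm_eq x _ hw
  have h₃ := hF.norm_eq x _ (add_mem hv hw)
  rw [map_add] at h₃
  rw [real_inner_eq_norm_add_mul_self_sub_norm_mul_self_sub_norm_mul_self_div_two,
    real_inner_eq_norm_add_mul_self_sub_norm_mul_self_sub_norm_mul_self_div_two, h₁, h₂, h₃]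

/-- The inner product of images only sees one horizontal component. -/
lemma inner_mfderiv_of_horizontal (hF : IsRiemannianSubmersion I J F) (v : TangentSpace I x)
    {w : TangentSpace I x} (hw : w ∈ horizontal I J F x) :
    inner ℝ (mfderiv I J F x v) (mfderiv I J F x w) = inner ℝ v w := by
  rw [← mfderiv_hor v, hF.inner_mfderiv (hor_mem F x v) hw, inner_hor_left, hor_of_horizontal hw]

variable [IsContMDiffRiemannianBundle J ∞ E' (fun x : N ↦ TangentSpace J x)]

lemma isSmoothField_hor (hF : IsRiemannianSubmersion I J F) (hX : IsSmoothField I X) :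
    IsSmoothField I (fun y ↦ hor I J F y (X y)) := by
  refine isSmoothField_of_inner fun x W hW ↦ ?_
  have hT : ContMDiff I.tangent J.tangent ∞ (tangentMap I J F) :=
    hF.smooth.contMDiff_tangentMap (by simp)
  have h₁ : CMDiffAt ∞ (fun y ↦ (⟨F y, mfderiv I J F y (X y)⟩ : TangentBundle J N)) x :=
    hT.contMDiffAt.comp x (hX.contMDiffAt x)
  have h₂ : CMDiffAt ∞ (fun y ↦ (⟨F y, mfderiv I J F y (W y)⟩ : TangentBundle J N)) x :=
    hT.contMDiffAt.comp x hW
  have h₃ := ContMDiffAt.inner_bundle (F := E') (E := fun x : N ↦ TangentSpace J x) h₁ h₂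
  refine h₃.congr_of_eventuallyEq (Filter.Eventually.of_forall fun y ↦ ?_)
  simp only
  rw [← mfderiv_hor (W y), hF.inner_mfderiv_of_horizontal _ (hor_mem F y _), inner_hor_left]

lemma isSmoothField_ver (hF : IsRiemannianSubmersion I J F) (hX : IsSmoothField I X) :
    IsSmoothField I (fun y ↦ ver I J F y (X y)) := by
  have e : (fun y ↦ ver I J F y (X y)) = fun y ↦ X y - hor I J F y (X y) := by
    ext y
    exact eq_sub_of_add_eq (ver_add_hor F y (X y))
  rw [e]
  exact hX.sub (hF.isSmoothField_hor hX)

end IsRiemannianSubmersion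

end Projection

section Submersion

variable {E : Type*} [NormedAddCommGroup E] [NormedSpace ℝ E] [FiniteDimensional ℝ E]
  {H : Type*} [TopologicalSpace H] {I : ModelWithCorners ℝ E H}
  {M : Type*} [TopologicalSpace M] [ChartedSpace H M] [IsManifold I ∞ M]
  [RiemannianBundle (fun x : M ↦ TangentSpace I x)]
  [IsContMDiffRiemannianBundle I ∞ E (fun x : M ↦ TangentSpace I x)]
  {E' : Type*} [NormedAddCommGroup E'] [NormedSpace ℝ E'] [FiniteDimensional ℝ E']
  {H' : Type*} [TopologicalSpace H'] {J : ModelWithCorners ℝ E' H'}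
  {N : Type*} [TopologicalSpace N] [ChartedSpace H' N] [IsManifold J ∞ N]
  [RiemannianBundle (fun x : N ↦ TangentSpace J x)]
  {X Y Z V W : Π x : M, TangentSpace I x} {F : M → N} {x : M}

lemma oneillA_vertical (hX : X x ∈ horizontal I J F x) (hV : ∀ y, V y ∈ vertical I J F y) :
    oneillA I J F X V x = hor I J F x (leviCivita I V x (X x)) := by
  have h₁ : (fun y ↦ hor I J F y (V y)) = fun y ↦ (0 : TangentSpace I y) :=
    funext fun y ↦ hor_of_vertical (hV y)
  have h₂ : (fun y ↦ ver I J F y (V y)) = V := funext fun y ↦ ver_of_vertical (hV y)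
  rw [oneillA, h₁, h₂, leviCivita_zero_field, map_zero, zero_add, hor_of_horizontal hX]

lemma fieldB_mem (S : SasakianStructure I M) (F : M → N) (X : Π x : M, TangentSpace I x) (y : M) :
    fieldB I J S F X y ∈ vertical I J F y :=
  ver_mem F y _

lemma inner_oneillA_vertical (hX : X x ∈ horizontal I J F x)
    (hV : ∀ y, V y ∈ vertical I J F y) {w : TangentSpace I x} (hw : w ∈ horizontal I J F x) :
    inner ℝ (oneillA I J F X V x) w = inner ℝ (leviCivita I V x (X x)) w := by
  rw [oneillA_vertical hX hV, inner_hor_left, hor_of_horizontal hw]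

lemma eventually_extend_zero (p : N) :
    ∀ᶠ q in 𝓝 p, FiberBundle.extend E' (E := TangentSpace J) (0 : TangentSpace J p) q = 0 := by
  let t := trivializationAt E' (TangentSpace J : N → Type _) p
  have hp : p ∈ t.baseSet := FiberBundle.mem_baseSet_trivializationAt E' _ p
  filter_upwards [t.open_baseSet.mem_nhds hp] with q hq
  change t.symm q (t ⟨p, 0⟩).2 = 0
  rw [← congrFun (t.coe_linearMapAt_of_mem (R := ℝ) hp) 0, map_zero,
    ← congrFun (t.coe_symmₗ (R := ℝ) hq) 0, map_zero]

lemma pullbackConnection_zero (hF : ContinuousAt F x) (v : TangentSpace I x) :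
    pullbackConnection I J F (fun y ↦ (0 : TangentSpace J (F y))) x v = 0 := by
  let t := trivializationAt E' (TangentSpace J : N → Type _) (F x)
  have hx : F x ∈ t.baseSet := FiberBundle.mem_baseSet_trivializationAt E' _ (F x)
  have hd : mvfderiv I (fun y ↦ (t ⟨F y, (0 : TangentSpace J (F y))⟩).2) x = 0 := by
    refine mvfderiv_of_eventuallyEq_zero ?_
    filter_upwards [hF.preimage_mem_nhds (t.open_baseSet.mem_nhds hx)] with y hy
    rw [← congrFun (t.coe_linearMapAt_of_mem (R := ℝ) hy) 0, map_zero]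
  have hs : t.symm (F x) (0 : E') = 0 := by
    rw [← congrFun (t.coe_symmₗ (R := ℝ) hx) 0, map_zero]
  simp only [pullbackConnection]
  rw [leviCivita_of_eventuallyEq_zero (eventually_extend_zero (F x)), hd, add_zero]
  exact hs

/-- `(∇F_*)(X, V) = -F_*(∇_X V)` for vertical `V`. -/
lemma secondFundamentalForm_vertical (hF : ContinuousAt F x)
    (hV : ∀ y, V y ∈ vertical I J F y) :
    secondFundamentalForm I J F X V x = -mfderiv I J F x (leviCivita I V x (X x)) := by
  have h : (fun y ↦ mfderiv I J F y (V y)) = fun y ↦ (0 : TangentSpace J (F y)) :=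
    funext fun y ↦ mfderiv_of_vertical (hV y)
  rw [secondFundamentalForm, h, pullbackConnection_zero hF, zero_sub]

lemma inner_secondFundamentalForm_vertical (hF : IsRiemannianSubmersion I J F)
    (hX : X x ∈ horizontal I J F x) (hV : ∀ y, V y ∈ vertical I J F y) {w : TangentSpace I x}
    (hw : w ∈ horizontal I J F x) :
    inner ℝ (secondFundamentalForm I J F X V x) (mfderiv I J F x w)
      = -inner ℝ (oneillA I J F X V x) w := by
  rw [secondFundamentalForm_vertical hF.smooth.continuous.continuousAt hV, inner_neg_left,
    hF.inner_mfderiv_of_horizontal _ hw, inner_oneillA_vertical hX hV hw]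

variable [IsContMDiffRiemannianBundle J ∞ E' (fun x : N ↦ TangentSpace J x)]
  {S : SasakianStructure I M}

namespace IsAntiInvariantSubmersion

lemma η_of_horizontal (hξ : S.ξ x ∈ vertical I J F x) {v : TangentSpace I x}
    (hv : v ∈ horizontal I J F x) : S.η x v = 0 := by
  rw [S.η_eq, real_inner_comm, inner_of_vertical_horizontal hξ hv]

lemma inner_φ_φ (hξ : S.ξ x ∈ vertical I J F x) {v w : TangentSpace I x}
    (hv : v ∈ horizontal I J F x) (hw : w ∈ vertical I J F x) :
    inner ℝ (S.φ x v) (S.φ x w) = 0 := by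
  rw [S.metric_φ, η_of_horizontal hξ hv, real_inner_comm, inner_of_vertical_horizontal hw hv]
  ring

/-- `g(φV, CY) = 0` for vertical `V` and horizontal `Y`. -/
lemma inner_hor_φ_φ (hF : IsAntiInvariantSubmersion I J S F) (hξ : S.ξ x ∈ vertical I J F x)
    {v w : TangentSpace I x} (hv : v ∈ horizontal I J F x) (hw : w ∈ vertical I J F x) :
    inner ℝ (hor I J F x (S.φ x v)) (S.φ x w) = 0 := by
  rw [inner_hor_left, hor_of_horizontal (hF.anti_invariant x w hw), inner_φ_φ hξ hv hw]

/-- `𝒜_X ξ = -CX`. -/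
lemma oneillA_ξ [T2Space M] (hX : IsHorizontalField I J F X)
    (hξ : ∀ x, S.ξ x ∈ vertical I J F x) (x : M) :
    oneillA I J F X S.ξ x = -hor I J F x (S.φ x (X x)) := by
  rw [oneillA_vertical (hX.2 x) hξ, S.leviCivita_ξ hX.1, map_neg]

/-- The part of `g([X, Y], V)` contributed by `∇_X Y`. -/
lemma inner_oneillA_fieldB [T2Space M] (hF : IsAntiInvariantSubmersion I J S F)
    (hξ : ∀ x, S.ξ x ∈ vertical I J F x)
    (hX : IsHorizontalField I J F X) (hY : IsHorizontalField I J F Y)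
    (hV : IsVerticalField I J F V) (x : M) :
    inner ℝ (oneillA I J F X (fieldB I J S F Y) x) (S.φ x (V x))
      = inner ℝ (leviCivita I Y x (X x)) (V x)
        - S.η x (leviCivita I Y x (X x)) * S.η x (V x)
        - inner ℝ (oneillA I J F Y S.ξ x) (S.φ x (oneillA I J F X V x))
        - S.η x (V x) * inner ℝ (X x) (S.φ x (Y x)) := by
  have hS := hF.toIsRiemannianSubmersion
  have hφV := S.isSmoothField_φ hV.1
  have hφY := S.isSmoothField_φ hY.1
  have hB : IsSmoothField I (fieldB I J S F Y) := hS.isSmoothField_ver hφY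
  have hVx := hF.anti_invariant x _ (hV.2 x)
  -- both `φY` and `BY` are orthogonal to `φV`
  have m₁ := mvfderiv_inner hX.1 hφY hφV x
  have m₂ := mvfderiv_inner hX.1 hB hφV x
  have e₁ : (fun y ↦ inner ℝ (S.φ y (Y y)) (S.φ y (V y))) = fun _ ↦ (0 : ℝ) :=
    funext fun y ↦ inner_φ_φ (hξ y) (hY.2 y) (hV.2 y)
  have e₂ : (fun y ↦ inner ℝ (fieldB I J S F Y y) (S.φ y (V y))) = fun _ ↦ (0 : ℝ) :=
    funext fun y ↦ inner_of_vertical_horizontal (fieldB_mem S F Y y)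
      (hF.anti_invariant y _ (hV.2 y))
  rw [e₁, mvfderiv_const] at m₁
  rw [e₂, mvfderiv_const] at m₂
  have n₁ := S.inner_leviCivita_φ hX.1 hY.1 hφV x
  obtain ⟨C, hC, hCx⟩ := IsSmoothField.exists_eq (I := I) x (hor I J F x (S.φ x (Y x)))
  have n₂ := S.inner_leviCivita_φ hX.1 hV.1 hC x
  have hdec : S.φ x (Y x) = fieldB I J S F Y x + hor I J F x (S.φ x (Y x)) :=
    (ver_add_hor F x _).symm
  have hXC : inner ℝ (X x) (hor I J F x (S.φ x (Y x))) = inner ℝ (X x) (S.φ x (Y x)) := by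
    rw [← inner_hor_left, hor_of_horizontal (hX.2 x)]
  have hXV : inner ℝ (X x) (V x) = 0 := by
    rw [real_inner_comm, inner_of_vertical_horizontal (hV.2 x) (hX.2 x)]
  have hA : inner ℝ (hor I J F x (S.φ x (Y x))) (S.φ x (leviCivita I V x (X x)))
      = inner ℝ (hor I J F x (S.φ x (Y x))) (S.φ x (oneillA I J F X V x)) := by
    rw [oneillA_vertical (hX.2 x) hV.2]
    conv_lhs => rw [← ver_add_hor (J := J) F x (leviCivita I V x (X x)), map_add, inner_add_right,
      hF.inner_hor_φ_φ (hξ x) (hY.2 x) (ver_mem F x _), zero_add]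
  rw [S.metric_φ, S.η_φ, η_of_horizontal (hξ x) (hY.2 x)] at n₁
  rw [hCx, hXV, hXC, real_inner_comm, real_inner_comm _ (S.φ x (leviCivita I V x (X x))), hA] at n₂
  rw [hdec, inner_add_left] at m₁
  rw [inner_oneillA_vertical (hX.2 x) (fieldB_mem S F Y) hVx, oneillA_ξ hY hξ, inner_neg_left]
  simp only [zero_apply] at m₁ m₂
  linear_combination m₁ - m₂ + n₁ + n₂

/-- The vertical part of the Lie bracket of horizontal fields. -/
lemma inner_mlieBracket_vertical [T2Space M] (hF : IsAntiInvariantSubmersion I J S F)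
    (hξ : ∀ x, S.ξ x ∈ vertical I J F x)
    (hX : IsHorizontalField I J F X) (hY : IsHorizontalField I J F Y)
    (hV : IsVerticalField I J F V) (x : M) :
    inner ℝ (mlieBracket I X Y x) (V x)
      = inner ℝ (oneillA I J F X (fieldB I J S F Y) x
            - oneillA I J F Y (fieldB I J S F X) x) (S.φ x (V x))
          - (inner ℝ (oneillA I J F X S.ξ x) (S.φ x (oneillA I J F Y V x))
            - inner ℝ (oneillA I J F Y S.ξ x) (S.φ x (oneillA I J F X V x))) := by
  have hη {U : Π x : M, TangentSpace I x} (hU : IsHorizontalField I J F U) :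
      (fun y ↦ S.η y (U y)) = fun _ ↦ (0 : ℝ) :=
    funext fun y ↦ η_of_horizontal (hξ y) (hU.2 y)
  have c := S.contact X Y hX.1 hY.1 x
  simp only [extDeriv, hη hX, hη hY, mvfderiv_const, zero_apply] at c
  have t := inner_mlieBracket hX.1 hY.1 S.smooth_ξ x
  simp only [← S.η_eq] at t
  have s : inner ℝ (Y x) (S.φ x (X x)) = -inner ℝ (X x) (S.φ x (Y x)) := by
    rw [real_inner_comm, S.inner_φ_left]
  rw [inner_sub_left, hF.inner_oneillA_fieldB hξ hX hY hV, hF.inner_oneillA_fieldB hξ hY hX hV,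
    inner_mlieBracket hX.1 hY.1 hV.1, s]
  linear_combination -2 * S.η x (V x) * c - S.η x (V x) * t

lemma horizontalIntegrable_iff [T2Space M] (hF : IsAntiInvariantSubmersion I J S F) :
    HorizontalIntegrable I J F ↔ ∀ X Y V : Π x : M, TangentSpace I x,
      IsHorizontalField I J F X → IsHorizontalField I J F Y → IsVerticalField I J F V →
        ∀ x, inner ℝ (mlieBracket I X Y x) (V x) = 0 := by
  refine ⟨fun h X Y V hX hY hV x ↦ ?_, fun h X Y hX hY x ↦ ?_⟩
  · rw [real_inner_comm, inner_of_vertical_horizontal (hV.2 x) (h X Y hX hY x)]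
  · refine (Submodule.mem_orthogonal _ _).2 fun v hv ↦ ?_
    obtain ⟨Z, hZ, hZx⟩ := IsSmoothField.exists_eq (I := I) x v
    have := h X Y _ hX hY
      ⟨hF.toIsRiemannianSubmersion.isSmoothField_ver hZ, fun y ↦ ver_mem F y (Z y)⟩ x
    simp only [hZx, ver_of_vertical hv] at this
    rwa [real_inner_comm]

end IsAntiInvariantSubmersion

end Submersion

end AntiInvariant

theorem theorem3
    {E : Type*} [NormedAddCommGroup E] [NormedSpace ℝ E] [FiniteDimensional ℝ E]
    {H : Type*} [TopologicalSpace H] (I : ModelWithCorners ℝ E H)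
    {M : Type*} [TopologicalSpace M] [ChartedSpace H M] [IsManifold I ∞ M]
    [T2Space M] [SecondCountableTopology M] [BoundarylessManifold I M]
    [RiemannianBundle (fun x : M ↦ TangentSpace I x)]
    [IsContMDiffRiemannianBundle I ∞ E (fun x : M ↦ TangentSpace I x)]
    {E' : Type*} [NormedAddCommGroup E'] [NormedSpace ℝ E'] [FiniteDimensional ℝ E']
    {H' : Type*} [TopologicalSpace H'] (J : ModelWithCorners ℝ E' H')
    {N : Type*} [TopologicalSpace N] [ChartedSpace H' N] [IsManifold J ∞ N]
    [T2Space N] [SecondCountableTopology N] [BoundarylessManifold J N]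
    [RiemannianBundle (fun x : N ↦ TangentSpace J x)]
    [IsContMDiffRiemannianBundle J ∞ E' (fun x : N ↦ TangentSpace J x)]
    (S : AntiInvariant.SasakianStructure I M) (F : M → N)
    (hF : AntiInvariant.IsAntiInvariantSubmersion I J S F)
    (hξ : ∀ x, S.ξ x ∈ AntiInvariant.vertical I J F x) :
    List.TFAE [
      AntiInvariant.HorizontalIntegrable I J F,
      ∀ X Y V : Π x : M, TangentSpace I x,
        AntiInvariant.IsHorizontalField I J F X → AntiInvariant.IsHorizontalField I J F Y →
        AntiInvariant.IsVerticalField I J F V → ∀ x,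
        inner ℝ (AntiInvariant.secondFundamentalForm I J F Y
              (AntiInvariant.fieldB I J S F X) x)
            (mfderiv I J F x (S.φ x (V x)))
          = inner ℝ (AntiInvariant.secondFundamentalForm I J F X
                (AntiInvariant.fieldB I J S F Y) x)
              (mfderiv I J F x (S.φ x (V x)))
            + inner ℝ (AntiInvariant.oneillA I J F X S.ξ x)
                (S.φ x (AntiInvariant.oneillA I J F Y V x))
            - inner ℝ (AntiInvariant.oneillA I J F Y S.ξ x)
                (S.φ x (AntiInvariant.oneillA I J F X V x)),
      ∀ X Y V : Π x : M, TangentSpace I x,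
        AntiInvariant.IsHorizontalField I J F X → AntiInvariant.IsHorizontalField I J F Y →
        AntiInvariant.IsVerticalField I J F V → ∀ x,
        inner ℝ (AntiInvariant.oneillA I J F X (AntiInvariant.fieldB I J S F Y) x
              - AntiInvariant.oneillA I J F Y (AntiInvariant.fieldB I J S F X) x)
            (S.φ x (V x))
          = inner ℝ (AntiInvariant.oneillA I J F X S.ξ x)
                (S.φ x (AntiInvariant.oneillA I J F Y V x))
            - inner ℝ (AntiInvariant.oneillA I J F Y S.ξ x)
                (S.φ x (AntiInvariant.oneillA I J F X V x))] := by
  have hS := hF.toIsRiemannianSubmersion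
  tfae_have 1 ↔ 3 := by
    rw [hF.horizontalIntegrable_iff]
    refine forall₃_congr fun X Y V ↦ forall₄_congr fun hX hY hV x ↦ ?_
    rw [hF.inner_mlieBracket_vertical hξ hX hY hV, sub_eq_zero]
  tfae_have 2 ↔ 3 := by
    refine forall₃_congr fun X Y V ↦ forall₄_congr fun hX hY hV x ↦ ?_
    have hVx := hF.anti_invariant x _ (hV.2 x)
    rw [AntiInvariant.inner_secondFundamentalForm_vertical hS (hY.2 x)
        (AntiInvariant.fieldB_mem S F X) hVx,
      AntiInvariant.inner_secondFundamentalForm_vertical hS (hX.2 x)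
        (AntiInvariant.fieldB_mem S F Y) hVx, inner_sub_left]
    constructor <;> intro h <;> linarith
  tfae_finish
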